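/- Let $\Omega=\{\omega\in C([0,1],\mathbb{R}) : \omega(0)=0\}$ be the Wiener space, let $\mathbb{W}$ be the Wiener measure on $\Omega$ and let $b_t(\omega)=\omega(t)$ for $t\in[0,1]$. Let $\langle\Pi_{\mathbb{R}}\rangle$ be the real vector space of random variables on $\Omega$ spanned by the products $\prod_{j=1}^m b_{t_j}^{i_j}$ with $m\in\mathbb{N}_0$, integers $i_1,\dots,i_m\ge 1$ and $t_1,\dots,t_m\in(0,1]$ (the polynomials of Brownian motion), and let $\langle\Pi_{\mathbb{Q}}\rangle\subseteq\langle\Pi_{\mathbb{R}}\rangle$ be the subspace spanned by those products with $t_1,\dots,t_m\in\mathbb{Q}\cap(0,1]$ (the polynomials of Brownian motion at rational times). Let $V\supseteq\langle\Pi_{\mathbb{Q}}\rangle$ be a vector space of real-valued random variables on $\Omega$ (for instance $V=\langle\Pi_{\mathbb{Q}}\rangle$), and let $\ell:V\to\mathbb{R}$ be a linear functional that is continuous with respect to the $L^1(\mathbb{W})$-distance $\mathbb{E}_{\mathbb{W}}|p-q|\in[0,\infty]$. Then there is an $L^1(\mathbb{W})$-continuous linear functional $L:\langle\Pi_{\mathbb{R}}\rangle\to\mathbb{R}$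 that agrees with $\ell$ on $V\cap\langle\Pi_{\mathbb{R}}\rangle$, and $L$ is the only $L^1(\mathbb{W})$-continuous linear functional on $\langle\Pi_{\mathbb{R}}\rangle$ that agrees with $\ell$ on $\langle\Pi_{\mathbb{Q}}\rangle$. Moreover, if $f\in\langle\Pi_{\mathbb{Q}}\rangle$ satisfies $\ell(g^2 f)\ge 0$ for all $g\in\langle\Pi_{\mathbb{Q}}\rangle$, then $L(g^2 f)\ge 0$ for all $g\in\langle\Pi_{\mathbb{R}}\rangle$. -/

import Mathlib

open MeasureTheory ProbabilityTheory

/-- The classical Wiener space: continuous real functions on `[0,1]` vanishing at `0`. -/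
def WienerSpace : Type := {ω : C(unitInterval, ℝ) // ω 0 = 0}

namespace WienerSpace

/-- The path-space projection `b_t : ω ↦ ω(t)`. -/
def b (t : unitInterval) (ω : WienerSpace) : ℝ := ω.1 t

/-- The σ-algebra generated by the projections `b_t`, `t ∈ [0,1]` (it coincides with the
Borel σ-algebra of the topology of uniform convergence). -/
instance : MeasurableSpace WienerSpace :=
  ⨆ t : unitInterval, MeasurableSpace.comap (b t) inferInstance

/-- `W` is the Wiener measure: under `W`, the coordinate process `b` (which starts at `0` and has
continuous paths) has independent increments, and the increment `b_t - b_s` is centred Gaussian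
with variance `t - s` for `s ≤ t`. -/
structure IsWienerMeasure (W : Measure WienerSpace) : Prop where
  isProbabilityMeasure : IsProbabilityMeasure W
  indep_increments : HasIndepIncrements b W
  gaussian_increments : ∀ s t : unitInterval, s ≤ t →
    HasLaw (fun ω ↦ b t ω - b s ω) (gaussianReal 0 (Real.toNNReal ((t : ℝ) - (s : ℝ)))) W

/-- The rational times in `(0,1]`. -/
def rationalTimes : Set unitInterval := {t | 0 < (t : ℝ) ∧ ∃ q : ℚ, (q : ℝ) = (t : ℝ)}

/-- All real times in `(0,1]`. -/
def realTimes : Set unitInterval := {t | 0 < (t : ℝ)}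

/-- The monomials `b_{t_1}^{i_1} ⋯ b_{t_m}^{i_m}` with `m ≥ 0`, all `i_j ≥ 1` and all `t_j ∈ T`,
as random variables on Wiener space. -/
def monomials (T : Set unitInterval) : Set (WienerSpace → ℝ) :=
  {Y | ∃ (m : ℕ) (i : Fin m → ℕ) (t : Fin m → unitInterval),
    (∀ j, 1 ≤ i j) ∧ (∀ j, t j ∈ T) ∧ Y = fun ω ↦ ∏ j, b (t j) ω ^ i j}

/-- The polynomials of Brownian motion at times in `T`: the linear span of the monomials, as a
vector space of random variables on Wiener space. -/
def polynomials (T : Set unitInterval) : Submodule ℝ (WienerSpace → ℝ) :=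
  Submodule.span ℝ (monomials T)

theorem monomials_mono {S T : Set unitInterval} (h : S ⊆ T) : monomials S ⊆ monomials T := by
  rintro Y ⟨m, i, t, hi, ht, rfl⟩
  exact ⟨m, i, t, hi, fun j ↦ h (ht j), rfl⟩

theorem polynomials_mono {S T : Set unitInterval} (h : S ⊆ T) : polynomials S ≤ polynomials T :=
  Submodule.span_mono (monomials_mono h)

theorem rationalTimes_subset : rationalTimes ⊆ realTimes := fun _ h ↦ h.1

theorem polynomials_rational_le : polynomials rationalTimes ≤ polynomials realTimes :=
  polynomials_mono rationalTimes_subset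

theorem mul_mem_polynomials {T : Set unitInterval} {p q : WienerSpace → ℝ}
    (hp : p ∈ polynomials T) (hq : q ∈ polynomials T) : p * q ∈ polynomials T := by
  have h := Submodule.mul_mem_mul hp hq
  rw [polynomials, Submodule.span_mul_span] at h
  refine Submodule.span_mono ?_ h
  rintro _ ⟨_, ⟨m, i, t, hi, ht, rfl⟩, _, ⟨n, k, s, hk, hs, rfl⟩, rfl⟩
  refine ⟨m + n, Fin.append i k, Fin.append t s, fun j ↦ ?_, fun j ↦ ?_, ?_⟩
  · induction j using Fin.addCases <;> simp [hi, hk]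
  · induction j using Fin.addCases <;> simp [ht, hs]
  · funext ω
    simp [Fin.prod_univ_add]

theorem sq_mul_mem_polynomials {T : Set unitInterval} {g f : WienerSpace → ℝ}
    (hg : g ∈ polynomials T) (hf : f ∈ polynomials T) : g ^ 2 * f ∈ polynomials T := by
  rw [pow_two]
  exact mul_mem_polynomials (mul_mem_polynomials hg hg) hf

/-- Continuity of a linear functional `ℓ`, defined on a vector space `V` of random variables,
with respect to the `L¹(W)`-distance `E_W |q - p|`. -/
def IsL1Continuous (W : Measure WienerSpace) {V : Submodule ℝ (WienerSpace → ℝ)}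
    (ℓ : V →ₗ[ℝ] ℝ) : Prop :=
  ∀ p : V, ∀ ε : ℝ, 0 < ε → ∃ δ : ℝ, 0 < δ ∧ ∀ q : V,
    eLpNorm ((q : WienerSpace → ℝ) - (p : WienerSpace → ℝ)) 1 W < ENNReal.ofReal δ →
      |ℓ q - ℓ p| < ε

end WienerSpace

/-! Existence is Hahn–Banach: continuity at 0 bounds `ℓ` by a multiple of the `L¹`-seminorm, and
this seminorm is finite on all polynomials because Gaussians have all moments. Uniqueness and
positivity come from density of the rational-time polynomials in every `L^r`, `1 ≤ r < ∞`. Brownian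
scaling gives `‖b_t - b_s‖_r = √(t - s) ‖N‖_r` with `N` standard normal, so `b_s → b_t` as rational
`s` increases to `t`. Hölder's inequality carries this to products. Each product doubles the
exponent, so inductions over polynomials must treat all finite `r` at once. -/

open Filter Topology ENNReal

/-! ### Convergence of sums and products in `L^r`. -/

namespace MeasureTheory

variable {Ω : Type*} [MeasurableSpace Ω] {μ : Measure Ω}

theorem tendsto_eLpNorm_add {r : ℝ≥0∞} (hr : 1 ≤ r) {u v : ℕ → Ω → ℝ} {p q : Ω → ℝ}
    (hu : ∀ n, AEStronglyMeasurable (u n) μ) (hv : ∀ n, AEStronglyMeasurable (v n) μ)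
    (hp : AEStronglyMeasurable p μ) (hq : AEStronglyMeasurable q μ)
    (hup : Tendsto (fun n ↦ eLpNorm (u n - p) r μ) atTop (𝓝 0))
    (hvq : Tendsto (fun n ↦ eLpNorm (v n - q) r μ) atTop (𝓝 0)) :
    Tendsto (fun n ↦ eLpNorm (u n + v n - (p + q)) r μ) atTop (𝓝 0) := by
  have h := hup.add hvq
  rw [add_zero] at h
  refine tendsto_of_tendsto_of_tendsto_of_le_of_le tendsto_const_nhds h (fun _ ↦ zero_le) fun n ↦ ?_
  rw [add_sub_add_comm]
  exact eLpNorm_add_le ((hu n).sub hp) ((hv n).sub hq) hr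

/-- Hölder applied to each term of `uv - pq = (u - p)(v - q) + (u - p)q + p(v - q)`. Only the limits
need finite norms. -/
theorem tendsto_eLpNorm_mul {a b r : ℝ≥0∞} [ENNReal.HolderTriple a b r] (hr : 1 ≤ r)
    {u v : ℕ → Ω → ℝ} {p q : Ω → ℝ}
    (hu : ∀ n, AEStronglyMeasurable (u n) μ) (hv : ∀ n, AEStronglyMeasurable (v n) μ)
    (hp : MemLp p a μ) (hq : MemLp q b μ)
    (hup : Tendsto (fun n ↦ eLpNorm (u n - p) a μ) atTop (𝓝 0))
    (hvq : Tendsto (fun n ↦ eLpNorm (v n - q) b μ) atTop (𝓝 0)) :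
    Tendsto (fun n ↦ eLpNorm (u n * v n - p * q) r μ) atTop (𝓝 0) := by
  have hup' := fun n ↦ (hu n).sub hp.1
  have hvq' := fun n ↦ (hv n).sub hq.1
  have hmul : ∀ {f g : Ω → ℝ}, AEStronglyMeasurable f μ → AEStronglyMeasurable g μ →
      eLpNorm (f * g) r μ ≤ eLpNorm f a μ * eLpNorm g b μ :=
    fun {f g} hf hg ↦ eLpNorm_smul_le_mul_eLpNorm (p := a) (q := b) (φ := f) (f := g) hg hf
  have h1 : Tendsto (fun n ↦ eLpNorm (u n - p) a μ * eLpNorm (v n - q) b μ) atTop (𝓝 0) := by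
    simpa using ENNReal.Tendsto.mul hup (.inr zero_ne_top) hvq (.inr zero_ne_top)
  have h2 : Tendsto (fun n ↦ eLpNorm (u n - p) a μ * eLpNorm q b μ) atTop (𝓝 0) := by
    simpa using ENNReal.Tendsto.mul_const hup (.inr hq.2.ne)
  have h3 : Tendsto (fun n ↦ eLpNorm p a μ * eLpNorm (v n - q) b μ) atTop (𝓝 0) := by
    simpa using ENNReal.Tendsto.const_mul hvq (.inr hp.2.ne)
  have h : Tendsto (fun n ↦ eLpNorm (u n - p) a μ * eLpNorm (v n - q) b μ +
      eLpNorm (u n - p) a μ * eLpNorm q b μ + eLpNorm p a μ * eLpNorm (v n - q) b μ)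
      atTop (𝓝 0) := by
    simpa using (h1.add h2).add h3
  refine tendsto_of_tendsto_of_tendsto_of_le_of_le tendsto_const_nhds h (fun _ ↦ zero_le) fun n ↦ ?_
  have e : u n * v n - p * q = (u n - p) * (v n - q) + (u n - p) * q + p * (v n - q) := by ring
  have m1 := (hup' n).mul (hvq' n)
  have m2 := (hup' n).mul hq.1
  have m3 := hp.1.mul (hvq' n)
  calc eLpNorm (u n * v n - p * q) r μ
      ≤ eLpNorm ((u n - p) * (v n - q) + (u n - p) * q) r μ + eLpNorm (p * (v n - q)) r μ := by
        rw [e]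
        exact eLpNorm_add_le (m1.add m2) m3 hr
    _ ≤ eLpNorm ((u n - p) * (v n - q)) r μ + eLpNorm ((u n - p) * q) r μ +
          eLpNorm (p * (v n - q)) r μ := by
        gcongr
        exact eLpNorm_add_le m1 m2 hr
    _ ≤ _ := add_le_add (add_le_add (hmul (hup' n) (hvq' n)) (hmul (hup' n) hq.1))
        (hmul hp.1 (hvq' n))

end MeasureTheory

theorem ENNReal.HolderTriple.two_mul_self (r : ℝ≥0∞) :
    ENNReal.HolderTriple (2 * r) (2 * r) r where
  inv_add_inv_eq_inv := by
    rw [ENNReal.mul_inv (by simp) (by simp), ← add_mul, ENNReal.inv_two_add_inv_two, one_mul]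

namespace WienerSpace

variable {W : Measure WienerSpace}

theorem measurable_b (t : unitInterval) : Measurable (b t) :=
  Measurable.of_comap_le (le_iSup (fun t ↦ MeasurableSpace.comap (b t) inferInstance) t)

theorem one_mem_polynomials (T : Set unitInterval) : (1 : WienerSpace → ℝ) ∈ polynomials T :=
  Submodule.subset_span ⟨0, Fin.elim0, Fin.elim0, fun j ↦ j.elim0, fun j ↦ j.elim0, by
    funext ω; simp⟩

theorem b_mem_polynomials {T : Set unitInterval} {t : unitInterval} (ht : t ∈ T) :
    b t ∈ polynomials T :=
  Submodule.subset_span ⟨1, fun _ ↦ 1, fun _ ↦ t, fun _ ↦ le_rfl, fun _ ↦ ht, by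
    funext ω; simp⟩

/-- To prove a property of all polynomials of Brownian motion, it suffices to check it on
constants and coordinates, and to check that it is stable under sums and products. -/
theorem polynomials_induction {T : Set unitInterval} {P : (WienerSpace → ℝ) → Prop}
    (const : ∀ c : ℝ, P fun _ ↦ c) (coord : ∀ t ∈ T, P (b t))
    (add : ∀ p q, P p → P q → P (p + q)) (mul : ∀ p q, P p → P q → P (p * q))
    {p : WienerSpace → ℝ} (hp : p ∈ polynomials T) : P p := by
  have hpow : ∀ q, P q → ∀ k : ℕ, P (q ^ k) := fun q hq k ↦ by
    induction k with
    | zero => exact const 1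
    | succ k ih => rw [pow_succ]; exact mul _ _ ih hq
  refine Submodule.span_induction ?_ (const 0) (fun p q _ _ ↦ add p q)
    (fun c p _ hp ↦ mul _ _ (const c) hp) hp
  rintro _ ⟨m, i, t, -, ht, rfl⟩
  have hprod : P (∏ j, b (t j) ^ i j) :=
    Finset.prod_induction _ P mul (const 1) fun j _ ↦ hpow _ (coord _ (ht j)) _
  convert hprod using 1
  funext ω
  simp

theorem measurable_of_mem_polynomials {T : Set unitInterval} {p : WienerSpace → ℝ}
    (hp : p ∈ polynomials T) : Measurable p :=
  polynomials_induction (P := Measurable) (fun _ ↦ measurable_const) (fun t _ ↦ measurable_b t)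
    (fun _ _ ↦ Measurable.add) (fun _ _ ↦ Measurable.mul) hp

/-! ### Moments and density of polynomials under Wiener measure. -/

namespace IsWienerMeasure

/-- Brownian scaling of the `L^r`-norm of an increment. -/
theorem eLpNorm_increment (hW : IsWienerMeasure W) {s t : unitInterval} (hst : s ≤ t)
    (r : ℝ≥0∞) :
    eLpNorm (b t - b s) r W =
      ENNReal.ofReal √((t : ℝ) - s) * eLpNorm id r (gaussianReal 0 1) := by
  have hts : (0 : ℝ) ≤ (t : ℝ) - s := sub_nonneg.2 hst
  have h := hW.gaussian_increments s t hst
  have hmap : (gaussianReal 0 1).map (√((t : ℝ) - s) * ·) =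
      gaussianReal 0 (Real.toNNReal ((t : ℝ) - s)) := by
    rw [gaussianReal_map_const_mul, mul_zero, mul_one]
    congr 1
    ext
    simp [Real.sq_sqrt hts, hts]
  calc eLpNorm (b t - b s) r W
      = eLpNorm id r (W.map fun ω ↦ b t ω - b s ω) :=
        (eLpNorm_map_measure aestronglyMeasurable_id h.aemeasurable).symm
    _ = eLpNorm id r ((gaussianReal 0 1).map (√((t : ℝ) - s) * ·)) := by rw [h.map_eq, hmap]
    _ = eLpNorm (√((t : ℝ) - s) • (id : ℝ → ℝ)) r (gaussianReal 0 1) :=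
        eLpNorm_map_measure aestronglyMeasurable_id (by fun_prop)
    _ = _ := by
        rw [eLpNorm_const_smul, Real.enorm_eq_ofReal (Real.sqrt_nonneg _)]

theorem memLp_b (hW : IsWienerMeasure W) (t : unitInterval) {r : ℝ≥0∞} (hr : r ≠ ∞) :
    MemLp (b t) r W := by
  refine ⟨(measurable_b t).aestronglyMeasurable, ?_⟩
  -- Paths start at 0, so `b t` is itself an increment.
  have h0 : b t = b t - b 0 := by
    funext ω
    simp [show b 0 ω = 0 from ω.2]
  rw [h0, hW.eLpNorm_increment unitInterval.nonneg']
  exact ENNReal.mul_lt_top ENNReal.ofReal_lt_top (memLp_id_gaussianReal' r hr).2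

theorem memLp_of_mem_polynomials (hW : IsWienerMeasure W) {T : Set unitInterval}
    {p : WienerSpace → ℝ} (hp : p ∈ polynomials T) {r : ℝ≥0∞} (hr : r ≠ ∞) : MemLp p r W := by
  have := hW.isProbabilityMeasure
  refine polynomials_induction (P := fun p ↦ ∀ r : ℝ≥0∞, r ≠ ∞ → MemLp p r W)
    (fun c _ _ ↦ memLp_const c) (fun t _ _ hr ↦ hW.memLp_b t hr)
    (fun _ _ hp hq r hr ↦ (hp r hr).add (hq r hr)) (fun _ _ hp hq r hr ↦ ?_) hp r hr
  have := ENNReal.HolderTriple.two_mul_self r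
  have h2 : 2 * r ≠ ∞ := ENNReal.mul_ne_top (by simp) hr
  exact (hq _ h2).mul (hp _ h2)

theorem exists_tendsto_b (hW : IsWienerMeasure W) {t : unitInterval} (ht : t ∈ realTimes)
    {r : ℝ≥0∞} (hr : r ≠ ∞) :
    ∃ u : ℕ → WienerSpace → ℝ, (∀ n, u n ∈ polynomials rationalTimes) ∧
      Tendsto (fun n ↦ eLpNorm (u n - b t) r W) atTop (𝓝 0) := by
  have ht0 : (0 : ℝ) < t := ht
  -- The maximum with 0 keeps `q` positive, since time 0 is not in `rationalTimes`; approaching from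
  -- below keeps `q ≤ 1`.
  have hq : ∀ n : ℕ, ∃ q : ℚ, max 0 ((t : ℝ) - 1 / ((n : ℝ) + 1)) < q ∧ (q : ℝ) < t := fun n ↦
    exists_rat_btwn (max_lt ht0 (sub_lt_self _ (by positivity)))
  choose q hq hqt using hq
  let s : ℕ → unitInterval := fun n ↦
    ⟨q n, ((le_max_left _ _).trans_lt (hq n)).le, (hqt n).le.trans t.2.2⟩
  have hs : ∀ n, s n ∈ rationalTimes := fun n ↦ ⟨(le_max_left _ _).trans_lt (hq n), q n, rfl⟩
  refine ⟨fun n ↦ b (s n), fun n ↦ b_mem_polynomials (hs n), ?_⟩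
  have hst : ∀ n, s n ≤ t := fun n ↦ (hqt n).le
  have heq : ∀ n, eLpNorm (b (s n) - b t) r W =
      ENNReal.ofReal √((t : ℝ) - s n) * eLpNorm id r (gaussianReal 0 1) := fun n ↦ by
    rw [eLpNorm_sub_comm, hW.eLpNorm_increment (hst n)]
  simp only [heq]
  have h0 : Tendsto (fun n ↦ (t : ℝ) - s n) atTop (𝓝 0) := by
    refine tendsto_of_tendsto_of_tendsto_of_le_of_le tendsto_const_nhds
      (tendsto_one_div_add_atTop_nhds_zero_nat (𝕜 := ℝ))
      (fun n ↦ sub_nonneg.2 (hst n)) fun n ↦ ?_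
    have := (le_max_right _ _).trans_lt (hq n)
    change (t : ℝ) - q n ≤ _
    linarith
  have h1 := ENNReal.tendsto_ofReal h0.sqrt
  have h2 := ENNReal.Tendsto.mul_const (b := eLpNorm id r (gaussianReal 0 1)) h1
    (.inr (memLp_id_gaussianReal' r hr).2.ne)
  simpa using h2

/-- Polynomials of Brownian motion at rational times are `L^r`-dense in the polynomials of
Brownian motion, for every finite `r ≥ 1`. -/
theorem exists_tendsto_of_mem_polynomials (hW : IsWienerMeasure W) {p : WienerSpace → ℝ}
    (hp : p ∈ polynomials realTimes) {r : ℝ≥0∞} (hr1 : 1 ≤ r) (hr : r ≠ ∞) :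
    ∃ u : ℕ → WienerSpace → ℝ, (∀ n, u n ∈ polynomials rationalTimes) ∧
      Tendsto (fun n ↦ eLpNorm (u n - p) r W) atTop (𝓝 0) := by
  -- Membership is carried along because sums need the limits measurable and products need them in
  -- `L^(2r)`.
  refine (polynomials_induction (P := fun p ↦ p ∈ polynomials realTimes ∧
    ∀ r : ℝ≥0∞, 1 ≤ r → r ≠ ∞ → ∃ u : ℕ → WienerSpace → ℝ,
      (∀ n, u n ∈ polynomials rationalTimes) ∧
      Tendsto (fun n ↦ eLpNorm (u n - p) r W) atTop (𝓝 0)) ?_ ?_ ?_ ?_ hp).2 r hr1 hr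
  · intro c
    have hc : ∀ T, (fun _ ↦ c) ∈ polynomials T := fun T ↦ by
      have h := (polynomials T).smul_mem c (one_mem_polynomials T)
      convert h using 1
      funext ω
      simp
    exact ⟨hc _, fun r _ _ ↦ ⟨fun _ _ ↦ c, fun _ ↦ hc _, by simp⟩⟩
  · exact fun t ht ↦ ⟨b_mem_polynomials ht, fun r _ hr ↦ hW.exists_tendsto_b ht hr⟩
  · rintro p q ⟨hp, hp'⟩ ⟨hq, hq'⟩
    refine ⟨add_mem hp hq, fun r hr1 hr ↦ ?_⟩
    obtain ⟨u, hu, hup⟩ := hp' r hr1 hr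
    obtain ⟨v, hv, hvq⟩ := hq' r hr1 hr
    exact ⟨fun n ↦ u n + v n, fun n ↦ add_mem (hu n) (hv n), tendsto_eLpNorm_add hr1
      (fun n ↦ (measurable_of_mem_polynomials (hu n)).aestronglyMeasurable)
      (fun n ↦ (measurable_of_mem_polynomials (hv n)).aestronglyMeasurable)
      (measurable_of_mem_polynomials hp).aestronglyMeasurable
      (measurable_of_mem_polynomials hq).aestronglyMeasurable hup hvq⟩
  · rintro p q ⟨hp, hp'⟩ ⟨hq, hq'⟩
    refine ⟨mul_mem_polynomials hp hq, fun r hr1 hr ↦ ?_⟩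
    have := ENNReal.HolderTriple.two_mul_self r
    have h2 : 2 * r ≠ ∞ := ENNReal.mul_ne_top (by simp) hr
    have h1 : 1 ≤ 2 * r := hr1.trans (ENNReal.HolderTriple.le (2 * r) (2 * r) r)
    obtain ⟨u, hu, hup⟩ := hp' _ h1 h2
    obtain ⟨v, hv, hvq⟩ := hq' _ h1 h2
    exact ⟨fun n ↦ u n * v n, fun n ↦ mul_mem_polynomials (hu n) (hv n), tendsto_eLpNorm_mul hr1
      (fun n ↦ (measurable_of_mem_polynomials (hu n)).aestronglyMeasurable)
      (fun n ↦ (measurable_of_mem_polynomials (hv n)).aestronglyMeasurable)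
      (hW.memLp_of_mem_polynomials hp h2) (hW.memLp_of_mem_polynomials hq h2) hup hvq⟩

/-- If `g_n → g` in `L⁴` then `g_n² f → g² f` in `L¹`; here `g_n` can be taken at rational
times. -/
theorem exists_tendsto_sq_mul (hW : IsWienerMeasure W) {f g : WienerSpace → ℝ}
    (hf : f ∈ polynomials rationalTimes) (hg : g ∈ polynomials realTimes) :
    ∃ u : ℕ → WienerSpace → ℝ, (∀ n, u n ∈ polynomials rationalTimes) ∧
      Tendsto (fun n ↦ eLpNorm (u n ^ 2 * f - g ^ 2 * f) 1 W) atTop (𝓝 0) := by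
  -- The exponents 2 and 4 stay in the form `2 * 1` and `2 * (2 * 1)` to match these Hölder triples.
  have i1 := ENNReal.HolderTriple.two_mul_self 1
  have i2 := ENNReal.HolderTriple.two_mul_self (2 * 1)
  have h2 : (2 * 1 : ℝ≥0∞) ≠ ∞ := by simp
  have h4 : (2 * (2 * 1) : ℝ≥0∞) ≠ ∞ := ENNReal.mul_ne_top (by simp) h2
  have l2 : (1 : ℝ≥0∞) ≤ 2 * 1 := by simp
  have l4 : (1 : ℝ≥0∞) ≤ 2 * (2 * 1) :=
    l2.trans (ENNReal.HolderTriple.le (2 * (2 * 1)) (2 * (2 * 1)) (2 * 1))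
  obtain ⟨u, hu, hug⟩ := hW.exists_tendsto_of_mem_polynomials hg l4 h4
  have hum := fun n ↦ (measurable_of_mem_polynomials (hu n)).aestronglyMeasurable (μ := W)
  have hgm := hW.memLp_of_mem_polynomials hg h4
  have hfm := hW.memLp_of_mem_polynomials hf h2
  have hsq := tendsto_eLpNorm_mul l2 hum hum hgm hgm hug hug
  refine ⟨u, hu, ?_⟩
  simp only [pow_two]
  exact tendsto_eLpNorm_mul le_rfl (fun n ↦ (hum n).mul (hum n)) (fun _ ↦ hfm.1) (hgm.mul hgm)
    hfm hsq (by simp)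

/-- The `L¹`-seminorm on the polynomials of Brownian motion. -/
noncomputable def seminorm (hW : IsWienerMeasure W) (T : Set unitInterval) :
    Seminorm ℝ (polynomials T) :=
  Seminorm.of (fun p ↦ (eLpNorm (p : WienerSpace → ℝ) 1 W).toReal)
    (fun p q ↦ by
      -- Finiteness matters: `toReal` sends `∞` to 0, which could break the triangle inequality.
      have hp := hW.memLp_of_mem_polynomials p.2 one_ne_top
      have hq := hW.memLp_of_mem_polynomials q.2 one_ne_top
      rw [← ENNReal.toReal_add hp.2.ne hq.2.ne]
      exact ENNReal.toReal_mono (ENNReal.add_ne_top.2 ⟨hp.2.ne, hq.2.ne⟩)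
        (eLpNorm_add_le hp.1 hq.1 le_rfl))
    (fun c p ↦ by simp [eLpNorm_const_smul])

end IsWienerMeasure

/-! ### Functionals continuous in `L¹`. -/

/-- Continuity at 0 with `ε = 1`, then homogeneity. `V` may contain non-integrable variables, hence
the finiteness condition. -/
theorem IsL1Continuous.exists_bound {V : Submodule ℝ (WienerSpace → ℝ)} {ℓ : V →ₗ[ℝ] ℝ}
    (hℓ : IsL1Continuous W ℓ) :
    ∃ C : ℝ, 0 ≤ C ∧ ∀ q : V, eLpNorm (q : WienerSpace → ℝ) 1 W ≠ ∞ →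
      |ℓ q| ≤ C * (eLpNorm (q : WienerSpace → ℝ) 1 W).toReal := by
  obtain ⟨δ, hδ, h⟩ := hℓ 0 1 one_pos
  refine ⟨δ⁻¹, by positivity, fun q hq ↦ ?_⟩
  set N := (eLpNorm (q : WienerSpace → ℝ) 1 W).toReal with hN
  have hN0 : 0 ≤ N := ENNReal.toReal_nonneg
  rw [inv_mul_eq_div, le_div_iff₀ hδ]
  -- `N` may be 0, so `q` is rescaled by `δ / M` for arbitrary `M > N` instead of being normalised.
  refine le_of_forall_gt_imp_ge_of_dense fun M hM ↦ ?_
  have hM0 : 0 < M := hN0.trans_lt hM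
  have hnorm : eLpNorm (((δ / M) • q : V) : WienerSpace → ℝ) 1 W < ENNReal.ofReal δ := by
    rw [Submodule.coe_smul, eLpNorm_const_smul, Real.enorm_eq_ofReal (by positivity),
      ← ENNReal.ofReal_toReal hq, ← hN, ← ENNReal.ofReal_mul (by positivity),
      ENNReal.ofReal_lt_ofReal_iff hδ, div_mul_eq_mul_div, div_lt_iff₀ hM0]
    exact mul_lt_mul_of_pos_left hM hδ
  have := h ((δ / M) • q) (by simpa using hnorm)
  rw [map_zero, sub_zero, map_smul, smul_eq_mul, abs_mul, abs_of_pos (by positivity),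
    div_mul_eq_mul_div, div_lt_one hM0] at this
  linarith

theorem IsL1Continuous.tendsto {V : Submodule ℝ (WienerSpace → ℝ)} {ℓ : V →ₗ[ℝ] ℝ}
    (hℓ : IsL1Continuous W ℓ) {u : ℕ → V} {p : V}
    (hu : Tendsto (fun n ↦ eLpNorm ((u n : WienerSpace → ℝ) - (p : WienerSpace → ℝ)) 1 W) atTop (𝓝 0)) :
    Tendsto (fun n ↦ ℓ (u n)) atTop (𝓝 (ℓ p)) := by
  refine Metric.tendsto_nhds.2 fun ε hε ↦ ?_
  obtain ⟨δ, hδ, h⟩ := hℓ p ε hε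
  filter_upwards [hu.eventually_lt_const (ENNReal.ofReal_pos.2 hδ)] with n hn
  exact h _ hn

theorem IsL1Continuous.of_bound {V : Submodule ℝ (WienerSpace → ℝ)} {ℓ : V →ₗ[ℝ] ℝ} {C : ℝ}
    (hC : 0 ≤ C) (h : ∀ q : V, |ℓ q| ≤ C * (eLpNorm (q : WienerSpace → ℝ) 1 W).toReal) :
    IsL1Continuous W ℓ := fun p ε hε ↦ by
  -- `C + 1` rather than `C`, which may be 0.
  refine ⟨ε / (C + 1), by positivity, fun q hq ↦ ?_⟩
  have hlt : (eLpNorm ((q - p : V) : WienerSpace → ℝ) 1 W).toReal < ε / (C + 1) :=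
    (ENNReal.lt_ofReal_iff_toReal_lt hq.ne_top).1 hq
  rw [lt_div_iff₀ (by positivity)] at hlt
  have hN : 0 ≤ (eLpNorm ((q - p : V) : WienerSpace → ℝ) 1 W).toReal := ENNReal.toReal_nonneg
  have := h (q - p)
  rw [map_sub] at this
  nlinarith

/-- Hahn–Banach: an `L¹`-continuous functional extends from `V ∩ ⟨Π⟩` to `⟨Π⟩`. -/
theorem IsL1Continuous.exists_extension (hW : IsWienerMeasure W) (T : Set unitInterval)
    {V : Submodule ℝ (WienerSpace → ℝ)} {ℓ : V →ₗ[ℝ] ℝ} (hℓ : IsL1Continuous W ℓ) :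
    ∃ L : polynomials T →ₗ[ℝ] ℝ, IsL1Continuous W L ∧
      ∀ (p : WienerSpace → ℝ) (hp : p ∈ V) (hp' : p ∈ polynomials T),
        L ⟨p, hp'⟩ = ℓ ⟨p, hp⟩ := by
  obtain ⟨C, hC, hbound⟩ := hℓ.exists_bound
  let S : Submodule ℝ (polynomials T) := V.comap (polynomials T).subtype
  let ι : S →ₗ[ℝ] V := ((polynomials T).subtype.comp S.subtype).codRestrict V fun x ↦ x.2
  -- The dominating seminorm is `C` times the `L¹`-seminorm, so the extension keeps the bound `C`.
  obtain ⟨L, hL, hLC⟩ := Module.Dual.exists_extension_of_le_seminorm S (ℓ.comp ι)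
    (p := (.mk C hC : NNReal) • hW.seminorm T)
    (fun x ↦ hbound (ι x) (hW.memLp_of_mem_polynomials x.1.2 one_ne_top).2.ne)
  exact ⟨L, .of_bound hC hLC, fun p hp hp' ↦ hL ⟨⟨p, hp'⟩, hp⟩⟩

end WienerSpace

theorem mainTheorem2
    (W : Measure WienerSpace) (hW : WienerSpace.IsWienerMeasure W)
    (V : Submodule ℝ (WienerSpace → ℝ))
    (hV : WienerSpace.polynomials WienerSpace.rationalTimes ≤ V)
    (ℓ : V →ₗ[ℝ] ℝ) (hℓ : WienerSpace.IsL1Continuous W ℓ) :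
    ∃ L : WienerSpace.polynomials WienerSpace.realTimes →ₗ[ℝ] ℝ,
      -- `L` is `L¹(W)`-continuous and agrees with `ℓ` wherever both are defined
      WienerSpace.IsL1Continuous W L ∧
      (∀ (p : WienerSpace → ℝ) (hp : p ∈ V)
        (hp' : p ∈ WienerSpace.polynomials WienerSpace.realTimes), L ⟨p, hp'⟩ = ℓ ⟨p, hp⟩) ∧
      -- uniqueness: already the values at rational times determine `L`
      (∀ L' : WienerSpace.polynomials WienerSpace.realTimes →ₗ[ℝ] ℝ,
        WienerSpace.IsL1Continuous W L' →
        (∀ (p : WienerSpace → ℝ) (hp : p ∈ WienerSpace.polynomials WienerSpace.rationalTimes),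
          L' ⟨p, WienerSpace.polynomials_rational_le hp⟩ = ℓ ⟨p, hV hp⟩) → L' = L) ∧
      -- positivity passes from rational to real times
      (∀ (f : WienerSpace → ℝ) (hf : f ∈ WienerSpace.polynomials WienerSpace.rationalTimes),
        (∀ (g : WienerSpace → ℝ) (hg : g ∈ WienerSpace.polynomials WienerSpace.rationalTimes),
          0 ≤ ℓ ⟨g ^ 2 * f, hV (WienerSpace.sq_mul_mem_polynomials hg hf)⟩) →
        ∀ (g : WienerSpace → ℝ) (hg : g ∈ WienerSpace.polynomials WienerSpace.realTimes),
          0 ≤ L ⟨g ^ 2 * f, WienerSpace.sq_mul_mem_polynomials hg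
            (WienerSpace.polynomials_rational_le hf)⟩) := by
  obtain ⟨L, hLc, hLℓ⟩ := hℓ.exists_extension hW WienerSpace.realTimes
  refine ⟨L, hLc, hLℓ, fun L' hL'c hL' ↦ ?_, fun f hf hpos g hg ↦ ?_⟩
  · ext ⟨p, hp⟩
    obtain ⟨u, hu, hup⟩ := hW.exists_tendsto_of_mem_polynomials hp le_rfl ENNReal.one_ne_top
    let v : ℕ → WienerSpace.polynomials WienerSpace.realTimes := fun n ↦
      ⟨u n, WienerSpace.polynomials_rational_le (hu n)⟩
    have h := hL'c.tendsto (u := v) (p := ⟨p, hp⟩) hup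
    have h' := hLc.tendsto (u := v) (p := ⟨p, hp⟩) hup
    refine tendsto_nhds_unique h (h'.congr fun n ↦ ?_)
    rw [hL' (u n) (hu n), hLℓ (u n) (hV (hu n))]
  · obtain ⟨u, hu, hug⟩ := hW.exists_tendsto_sq_mul hf hg
    have hmem := fun n ↦ WienerSpace.sq_mul_mem_polynomials (hu n) hf
    have h := hLc.tendsto
      (u := fun n ↦ ⟨u n ^ 2 * f, WienerSpace.polynomials_rational_le (hmem n)⟩)
      (p := ⟨g ^ 2 * f, WienerSpace.sq_mul_mem_polynomials hg
        (WienerSpace.polynomials_rational_le hf)⟩) hug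
    refine ge_of_tendsto' h fun n ↦ ?_
    rw [hLℓ _ (hV (hmem n))]
    exact hpos _ (hu n)
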